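/- All algebras are nonempty and of a fixed signature without relation symbols. For a class $\mathcal{K}$ of algebras let $\mathbb{I}(\mathcal{K})$, $\mathbb{S}(\mathcal{K})$, $\mathbb{P}(\mathcal{K})$ and $\mathbb{P}_u(\mathcal{K})$ be the classes of isomorphic copies, subalgebras, direct products (the empty product is a one-element algebra) and ultraproducts of members of $\mathcal{K}$; let $\mathcal{K}\times\mathcal{K}=\{\mathbf{A}\times\mathbf{B}\mid \mathbf{A},\mathbf{B}\in\mathcal{K}\}$. The quasivariety generated by $\mathcal{K}$ is $\mathbb{ISPP}_u(\mathcal{K})$; a quasivariety is finitely generated if it is generated by a finite set of finite algebras. A majority term for $\mathcal{K}$ is a ternary term $t$ such that every member of $\mathcal{K}$ satisfies $t(x,x,y)=t(x,y,x)=t(y,x,x)=x$. A homomorphism $h:\mathbf{A}\to\mathbf{B}$ with $\mathbf{A},\mathbf{B}\in\mathcal{K}$ is a $\mathcal{K}$-epimorphism if for all $\mathbf{C}\in\mathcal{K}$ and all homomorphisms $g,g':\mathbf{B}\to\mathbf{C}$, $gh=g'h$ implies $g=g'$; the class $\mathcal{K}$ has surjective epimorphisms if every $\mathcal{K}$-epimorphism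 is surjective. For a quasivariety $\mathcal{Q}$ and $\mathbf{A}\in\mathcal{Q}$, a $\mathcal{Q}$-congruence of $\mathbf{A}$ is a congruence $\theta$ with $\mathbf{A}/\theta\in\mathcal{Q}$; $\mathbf{A}$ is relatively subdirectly irreducible if its diagonal congruence is completely meet irreducible in the lattice of $\mathcal{Q}$-congruences of $\mathbf{A}$, i.e. belongs to every set of $\mathcal{Q}$-congruences whose meet it is. Let $\mathcal{Q}_{RSI}$ be the class of relatively subdirectly irreducible members of $\mathcal{Q}$. **Corollary.** Let $\mathcal{Q}$ be a finitely generated quasivariety with a majority term. The following are equivalent: 1. $\mathcal{Q}$ has surjective epimorphisms. 2. $\mathbb{S}(\mathcal{Q}_{RSI}\times\mathcal{Q}_{RSI})$ has surjective epimorphisms. -/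

import Mathlib

open FirstOrder FirstOrder.Language

universe u v w

namespace UniversalAlgebra

/-- The algebras (nonempty structures) with carrier in `Type w` in the signature `L`.  It is used
only for signatures without relation symbols (`L.IsAlgebraic`); the empty theory imposes no
condition. -/
abbrev Alg (L : FirstOrder.Language.{u, v}) : Type (max u v (w + 1)) :=
  Theory.ModelType.{u, v, w} (∅ : L.Theory)

variable {L : FirstOrder.Language.{u, v}}

/-! ### Products, subalgebras, class operators -/

/-- The direct product of a family of structures, with componentwise operations. -/
instance piStructure {I : Type*} (M : I → Type*) [∀ i, L.Structure (M i)] :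
    L.Structure (∀ i, M i) where
  funMap f x := fun i => Structure.funMap f (fun k => x k i)
  RelMap r x := ∀ i, Structure.RelMap r (fun k => x k i)

/-- The direct product of two structures, with componentwise operations. -/
instance prodStructure (M N : Type*) [L.Structure M] [L.Structure N] : L.Structure (M × N) where
  funMap f x := (Structure.funMap f (fun k => (x k).1), Structure.funMap f (fun k => (x k).2))
  RelMap r x := Structure.RelMap r (fun k => (x k).1) ∧ Structure.RelMap r (fun k => (x k).2)

/-- The product algebra `∏ i, M i`; for empty `I` it is a one-element algebra. -/
def Alg.pi {I : Type w} (M : I → Alg.{u, v, w} L) : Alg.{u, v, w} L :=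
  Theory.ModelType.of ∅ (∀ i, M i)

/-- The product algebra `A × B`. -/
def Alg.prod (A B : Alg.{u, v, w} L) : Alg.{u, v, w} L :=
  Theory.ModelType.of ∅ (A × B)

/-- The ultraproduct of the family `M` over the ultrafilter `U`. -/
def Alg.ultraproduct {I : Type w} (U : Ultrafilter I) (M : I → Alg.{u, v, w} L) :
    Alg.{u, v, w} L :=
  Theory.ModelType.of ∅ ((U : Filter I).Product (fun i => M i))

/-- A nonempty subuniverse of `A`, as an algebra. -/
def Alg.sub (A : Alg.{u, v, w} L) (S : L.Substructure A) (hS : Nonempty S) : Alg.{u, v, w} L :=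
  Theory.ModelType.of ∅ S

/-- `𝕀(K)`: isomorphic copies of members of `K`. -/
def ClassI (K : Set (Alg.{u, v, w} L)) : Set (Alg.{u, v, w} L) :=
  {A | ∃ B ∈ K, Nonempty (B ≃[L] A)}

/-- `𝕊(K)`: subalgebras of members of `K`. -/
def ClassS (K : Set (Alg.{u, v, w} L)) : Set (Alg.{u, v, w} L) :=
  {A | ∃ B ∈ K, ∃ (S : L.Substructure B) (hS : Nonempty S), A = B.sub S hS}

/-- `ℙ(K)`: direct products of families of members of `K`. -/
def ClassP (K : Set (Alg.{u, v, w} L)) : Set (Alg.{u, v, w} L) :=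
  {A | ∃ (I : Type w) (M : I → Alg.{u, v, w} L), (∀ i, M i ∈ K) ∧ A = Alg.pi M}

/-- `ℙᵤ(K)`: ultraproducts of families of members of `K`. -/
def ClassPu (K : Set (Alg.{u, v, w} L)) : Set (Alg.{u, v, w} L) :=
  {A | ∃ (I : Type w) (U : Ultrafilter I) (M : I → Alg.{u, v, w} L),
    (∀ i, M i ∈ K) ∧ A = Alg.ultraproduct U M}

/-- `K × K = {A × B | A, B ∈ K}`. -/
def ClassSquare (K : Set (Alg.{u, v, w} L)) : Set (Alg.{u, v, w} L) :=
  {C | ∃ A ∈ K, ∃ B ∈ K, C = A.prod B}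

/-- The quasivariety `ℚ(K) = 𝕀𝕊ℙℙᵤ(K)` generated by `K`. -/
def quasivarietyGenerated (K : Set (Alg.{u, v, w} L)) : Set (Alg.{u, v, w} L) :=
  ClassI (ClassS (ClassP (ClassPu K)))

/-- `Q` is a finitely generated quasivariety: it is generated by a finite set of finite algebras. -/
def IsFinitelyGeneratedQuasivariety (Q : Set (Alg.{u, v, w} L)) : Prop :=
  ∃ F : Set (Alg.{u, v, w} L), F.Finite ∧ (∀ A ∈ F, Finite A) ∧ Q = quasivarietyGenerated F

/-! ### Majority terms and epimorphisms -/

/-- The ternary term `t` is a majority term for `K`: every member of `K` satisfies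
`t(x,x,y) = t(x,y,x) = t(y,x,x) = x`. -/
def IsMajorityTerm (K : Set (Alg.{u, v, w} L)) (t : L.Term (Fin 3)) : Prop :=
  ∀ A ∈ K, ∀ x y : A,
    t.realize ![x, x, y] = x ∧ t.realize ![x, y, x] = x ∧ t.realize ![y, x, x] = x

/-- `K` has a majority term. -/
def HasMajorityTerm (K : Set (Alg.{u, v, w} L)) : Prop :=
  ∃ t : L.Term (Fin 3), IsMajorityTerm K t

/-- The homomorphism `h : A → B` is a `K`-epimorphism. -/
def IsEpimorphismIn (K : Set (Alg.{u, v, w} L)) {A B : Alg.{u, v, w} L} (h : A →[L] B) : Prop :=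
  ∀ C ∈ K, ∀ g g' : B →[L] C, g.comp h = g'.comp h → g = g'

/-- Every `K`-epimorphism between members of `K` is surjective. -/
def HasSurjectiveEpimorphisms (K : Set (Alg.{u, v, w} L)) : Prop :=
  ∀ A ∈ K, ∀ B ∈ K, ∀ h : A →[L] B, IsEpimorphismIn K h → Function.Surjective h

/-! ### Relative congruences and relatively subdirectly irreducible algebras -/

/-- Congruences of an algebra. -/
structure Congruence (A : Alg.{u, v, w} L) extends Setoid A where
  map_rel : ∀ {n : ℕ} (f : L.Functions n) (x y : Fin n → A),
    (∀ i, toSetoid (x i) (y i)) → toSetoid (Structure.funMap f x) (Structure.funMap f y)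

/-- Congruences are ordered by inclusion. -/
instance (A : Alg.{u, v, w} L) : PartialOrder (Congruence A) :=
  PartialOrder.lift Congruence.toSetoid (by
    rintro ⟨s, hs⟩ ⟨t, ht⟩ h
    cases h
    rfl)

/-- The diagonal congruence, that is, equality. -/
def Congruence.diagonal (A : Alg.{u, v, w} L) : Congruence A where
  toSetoid := ⊥
  map_rel f x y h := by
    have hxy : x = y := funext h
    rw [hxy]

/-- The operations of an algebra respect a congruence. -/
instance Congruence.prestructure [L.IsAlgebraic] {A : Alg.{u, v, w} L} (θ : Congruence A) :
    L.Prestructure θ.toSetoid where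
  toStructure := inferInstance
  fun_equiv {_ f} x y h := θ.map_rel f x y h
  rel_equiv {_ r} _ _ _ := isEmptyElim r

/-- The quotient algebra `A / θ`. -/
def Alg.quotient [L.IsAlgebraic] (A : Alg.{u, v, w} L) (θ : Congruence A) : Alg.{u, v, w} L :=
  haveI : Nonempty (Quotient θ.toSetoid) := A.nonempty'.map (Quotient.mk θ.toSetoid)
  Theory.ModelType.of ∅ (Quotient θ.toSetoid)

/-- The `Q`-congruences of `A`: the congruences `θ` with `A / θ ∈ Q`, ordered by inclusion. -/
abbrev RelCongruence [L.IsAlgebraic] (Q : Set (Alg.{u, v, w} L)) (A : Alg.{u, v, w} L) :=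
  {θ : Congruence A // A.quotient θ ∈ Q}

/-- `a` belongs to every set of elements whose meet is `a`.  (As the meet of the empty set is the
top element, the top element does not have this property.) -/
def IsCompletelyMeetIrreducible {α : Type*} [PartialOrder α] (a : α) : Prop :=
  ∀ T : Set α, IsGLB T a → a ∈ T

/-- The class `Q_RSI` of relatively subdirectly irreducible members of `Q`: those `A ∈ Q` whose
diagonal congruence is completely meet irreducible in the lattice of `Q`-congruences of `A`. -/
def ClassRSI [L.IsAlgebraic] (Q : Set (Alg.{u, v, w} L)) : Set (Alg.{u, v, w} L) :=
  {A | A ∈ Q ∧ ∃ h : A.quotient (Congruence.diagonal A) ∈ Q,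
    IsCompletelyMeetIrreducible (⟨Congruence.diagonal A, h⟩ : RelCongruence Q A)}

end UniversalAlgebra

/-! ### Separation of points and limits along ultrafilters -/

namespace UniversalAlgebra

open Filter

variable {L : FirstOrder.Language.{u, v}}

/-! An ultraproduct of members of a finite set `F` of finite algebras embeds in a member of `F`, so
the generated quasivariety consists of the algebras whose points are separated by homomorphisms into
`F` (`mem_quasivarietyGenerated_iff`). Taking separating homomorphisms with smallest image replaces
`F` by a finite set `R` of finite relatively subdirectly irreducible algebras.

Write `K` for 𝕊(Q_RSI × Q_RSI), a subclass of `Q`. Members of `R` embed diagonally in members of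
`K`, so `K` has enough targets to test `Q`-epimorphisms: every `K`-epimorphism is a `Q`-epimorphism.
Hence `Q` passes surjective epimorphisms on to `K`.

Conversely, let `h : A → B` be a `Q`-epimorphism missing a point `b`. By a Baker–Pixley argument,
the majority term yields `M`, `N` in `R` and `p : B → M × N` with `p b` outside `p (h A)`
(`exists_pair_separating`). The inclusion of `p (h A)` in `p B` is then a nonsurjective
`K`-epimorphism (`exists_range_eq_of_hasSurjectiveEpimorphisms`). Two factors suffice because a
majority term reduces agreement on finitely many coordinates to agreement on pairs; compactness
handles algebras that are not finitely generated. -/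

/-- The algebra `B` has its points separated by homomorphisms into members of `K`. -/
def SeparatedBy (K : Set (Alg.{u, v, w} L)) (B : Alg.{u, v, w} L) : Prop :=
  ∀ x y : B, x ≠ y → ∃ M ∈ K, ∃ φ : B →[L] M, φ x ≠ φ y

/-- In a signature without relation symbols, a map preserving the operations is a homomorphism. -/
def homOfMapFun [L.IsAlgebraic] {M N : Type*} [L.Structure M] [L.Structure N] (f : M → N)
    (hf : ∀ {n : ℕ} (F : L.Functions n) (x : Fin n → M),
      f (Structure.funMap F x) = Structure.funMap F (f ∘ x)) : M →[L] N where
  toFun := f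
  map_fun' := hf
  map_rel' r := isEmptyElim r

/-- The pushforward of an ultrafilter to a finite type is principal. -/
theorem exists_eventually_eq {I α : Type*} [Finite α] (U : Ultrafilter I) (s : I → α) :
    ∃ a, ∀ᶠ i in (U : Filter I), s i = a := by
  obtain ⟨a, ha⟩ := (U.map s).eq_pure_of_finite
  refine ⟨a, ?_⟩
  have : {a} ∈ U.map s := by rw [ha]; exact Ultrafilter.mem_pure.2 rfl
  exact this

/-- A pointwise limit along an ultrafilter of maps to a finite algebra that eventually commute with
each given application of an operation is a homomorphism. -/
theorem exists_hom_eventually_eq [L.IsAlgebraic] {I : Type*} (U : Ultrafilter I) {M N : Type*}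
    [L.Structure M] [L.Structure N] [Finite N] (s : I → M → N)
    (hs : ∀ {n : ℕ} (F : L.Functions n) (x : Fin n → M), ∀ᶠ i in (U : Filter I),
      s i (Structure.funMap F x) = Structure.funMap F (s i ∘ x)) :
    ∃ f : M →[L] N, ∀ x, ∀ᶠ i in (U : Filter I), s i x = f x := by
  choose f hf using fun x => exists_eventually_eq U (fun i => s i x)
  refine ⟨homOfMapFun f fun F x => ?_, hf⟩
  -- Arities are finite, so all arguments reach their limits at a common index.
  have h1 : ∀ᶠ i in (U : Filter I), ∀ k, s i (x k) = f (x k) :=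
    eventually_all.2 fun k => hf (x k)
  obtain ⟨i, hi1, hi2, hi3⟩ := (h1.and ((hs F x).and (hf _))).exists
  rw [← hi3, hi2]
  congr 1
  exact funext hi1

/-! ### Projections, pairings and factorization through quotients -/

section Homs

/-- The inclusion of a subalgebra. -/
def Alg.subtype (A : Alg.{u, v, w} L) (S : L.Substructure A) (hS : Nonempty S) :
    A.sub S hS →[L] A := S.subtype.toHom

theorem Alg.subtype_injective (A : Alg.{u, v, w} L) (S : L.Substructure A) (hS : Nonempty S) :
    Function.Injective (A.subtype S hS) := S.subtype.injective

variable [L.IsAlgebraic]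

/-- A coordinate projection of a product of a family of algebras. -/
def Alg.evalHom {I : Type w} (M : I → Alg.{u, v, w} L) (i : I) : Alg.pi M →[L] M i :=
  homOfMapFun (M := ∀ i, M i) (fun x => x i) fun _ _ => rfl

/-- The homomorphism to a product of a family of algebras with given coordinates. -/
def Alg.piHom {I : Type w} (M : I → Alg.{u, v, w} L) {B : Alg.{u, v, w} L}
    (f : ∀ i, B →[L] M i) : B →[L] Alg.pi M :=
  homOfMapFun (N := ∀ i, M i) (fun x i => f i x) fun F x => funext fun i => (f i).map_fun F x

/-- The first projection of a product of two algebras. -/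
def Alg.fst (A B : Alg.{u, v, w} L) : A.prod B →[L] A :=
  homOfMapFun (M := A × B) Prod.fst fun _ _ => rfl

/-- The second projection of a product of two algebras. -/
def Alg.snd (A B : Alg.{u, v, w} L) : A.prod B →[L] B :=
  homOfMapFun (M := A × B) Prod.snd fun _ _ => rfl

/-- The homomorphism to a product of two algebras with given coordinates. -/
def Alg.pair {A B C : Alg.{u, v, w} L} (f : C →[L] A) (g : C →[L] B) : C →[L] A.prod B :=
  homOfMapFun (N := A × B) (fun x => (f x, g x)) fun F x =>
    Prod.ext (f.map_fun F x) (g.map_fun F x)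

theorem Alg.pair_eq_iff {A B C : Alg.{u, v, w} L} (f : C →[L] A) (g : C →[L] B) (x y : C) :
    Alg.pair f g x = Alg.pair f g y ↔ f x = f y ∧ g x = g y :=
  Prod.ext_iff

theorem Alg.prod_ext {A B : Alg.{u, v, w} L} {x y : A.prod B}
    (h1 : A.fst B x = A.fst B y) (h2 : A.snd B x = A.snd B y) : x = y :=
  Prod.ext h1 h2

/-- The quotient map. -/
def Alg.quotientMk (A : Alg.{u, v, w} L) (θ : Congruence A) : A →[L] A.quotient θ :=
  homOfMapFun (N := Quotient θ.toSetoid) (Quotient.mk θ.toSetoid) fun F x =>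
    (funMap_quotient_mk' θ.toSetoid F x).symm

theorem Alg.quotientMk_surjective (A : Alg.{u, v, w} L) (θ : Congruence A) :
    Function.Surjective (A.quotientMk θ) := Quotient.mk_surjective

theorem Alg.quotientMk_eq_iff (A : Alg.{u, v, w} L) (θ : Congruence A) (x y : A) :
    A.quotientMk θ x = A.quotientMk θ y ↔ θ.toSetoid x y := Quotient.eq (r := θ.toSetoid)

/-- A homomorphism whose kernel contains that of a surjective homomorphism factors through it. -/
theorem exists_comp_eq_of_surjective {A B C : Type*} [L.Structure A] [L.Structure B]
    [L.Structure C] (p : A →[L] B) (hp : Function.Surjective p) (f : A →[L] C)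
    (h : ∀ x y, p x = p y → f x = f y) : ∃ g : B →[L] C, ∀ x, g (p x) = f x := by
  choose s hs using hp
  have key : ∀ x, f (s (p x)) = f x := fun x => h _ _ (hs _)
  refine ⟨homOfMapFun (fun b => f (s b)) fun F x => ?_, key⟩
  have hx : x = p ∘ (s ∘ x) := funext fun i => (hs _).symm
  conv_lhs => rw [hx, ← p.map_fun, key, f.map_fun]
  rfl

end Homs

/-! ### The generated quasivariety as the class of separated algebras -/

section Generation

theorem SeparatedBy.of_hom {K : Set (Alg.{u, v, w} L)} {A B : Alg.{u, v, w} L}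
    (hB : SeparatedBy K B) (f : A →[L] B) (hf : Function.Injective f) : SeparatedBy K A := by
  intro x y hxy
  obtain ⟨M, hM, φ, hφ⟩ := hB _ _ (hf.ne hxy)
  exact ⟨M, hM, φ.comp f, hφ⟩

variable [L.IsAlgebraic]

/-- An ultraproduct of members of a finite set of finite algebras has its points separated by
homomorphisms into the set. -/
theorem separatedBy_ultraproduct {F : Set (Alg.{u, v, w} L)} (hF : F.Finite)
    (hfin : ∀ A ∈ F, Finite A) {I : Type w} (U : Ultrafilter I) (M : I → Alg.{u, v, w} L)
    (hM : ∀ i, M i ∈ F) : SeparatedBy F (Alg.ultraproduct U M) := by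
  have := hF.to_subtype
  obtain ⟨⟨N, hN⟩, hMN⟩ := exists_eventually_eq U (fun i => (⟨M i, hM i⟩ : F))
  have hMN : ∀ᶠ i in (U : Filter I), M i = N := hMN.mono fun i hi => congrArg Subtype.val hi
  have := hfin N hN
  -- `c` is the identity where `M i = N` and an arbitrary constant on the negligible set of other
  -- indices.
  have hc : ∀ i, ∃ c : M i → N, M i = N → Function.Injective c ∧
      ∀ {n : ℕ} (G : L.Functions n) (x : Fin n → M i),
        c (Structure.funMap G x) = Structure.funMap G (c ∘ x) := by
    intro i
    by_cases h : M i = N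
    · rw [h]
      exact ⟨id, fun _ => ⟨Function.injective_id, fun _ _ => rfl⟩⟩
    · exact ⟨fun _ => N.nonempty'.some, fun h' => absurd h' h⟩
  choose c hc using hc
  let P := Theory.ModelType.of (∅ : L.Theory) (∀ i, M i)
  obtain ⟨f, hf⟩ := exists_hom_eventually_eq (M := P) U (fun i x => c i (x i))
    (fun F x => hMN.mono fun i hi => (hc i hi).2 F _)
  let p : P →[L] Alg.ultraproduct U M := homOfMapFun
    (N := (U : Filter I).Product (fun i => M i))
    (Quotient.mk ((U : Filter I).productSetoid fun i => M i))
    fun F x => (Ultraproduct.funMap_cast F x).symm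
  have hp : Function.Surjective p :=
    Quotient.mk_surjective (s := (U : Filter I).productSetoid fun i => M i)
  have hpe : ∀ x y, p x = p y ↔ ∀ᶠ i in (U : Filter I), x i = y i := fun x y =>
    Quotient.eq (r := (U : Filter I).productSetoid fun i => M i)
  have hpf : ∀ x y, p x = p y ↔ f x = f y := by
    intro x y
    rw [hpe]
    constructor
    · intro h
      obtain ⟨i, h, h1, h2⟩ := (h.and ((hf x).and (hf y))).exists
      rw [← h1, ← h2, h]
    · intro h
      filter_upwards [hf x, hf y, hMN] with i h1 h2 h3
      exact (hc i h3).1 (h1.trans (h.trans h2.symm))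
  obtain ⟨g, hg⟩ := exists_comp_eq_of_surjective p hp f fun x y => (hpf x y).1
  intro x y hxy
  obtain ⟨x, rfl⟩ := hp x
  obtain ⟨y, rfl⟩ := hp y
  refine ⟨N, hN, g, ?_⟩
  rw [hg, hg]
  exact fun h => hxy ((hpf x y).2 h)

/-- Every algebra embeds in an ultrapower of itself. -/
theorem exists_mem_classPu_equiv {K : Set (Alg.{u, v, w} L)} {M : Alg.{u, v, w} L} (hM : M ∈ K) :
    ∃ N ∈ ClassPu K, ∃ f : M →[L] N, Function.Injective f := by
  -- The ultrapower over a one-point index set is enough.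
  let U : Ultrafilter PUnit.{w + 1} := pure PUnit.unit
  refine ⟨Alg.ultraproduct U (fun _ => M), ⟨_, U, _, fun _ => hM, rfl⟩,
    homOfMapFun (N := (U : Filter PUnit).Product (fun _ => M))
      (fun x => ((fun _ => x : PUnit → M) : (U : Filter PUnit).Product (fun _ => M)))
      fun F x => (Ultraproduct.funMap_cast (u := U) F (fun k _ => x k)).symm, ?_⟩
  intro x y hxy
  have : ∀ᶠ _ in (U : Filter PUnit.{w + 1}), x = y := Quotient.exact hxy
  exact this.exists.choose_spec

/-- Separation passes to products and subalgebras, and ultraproducts add nothing new. Conversely,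
one separating homomorphism for each pair of distinct points gives an embedding in a product. -/
theorem mem_quasivarietyGenerated_iff {F : Set (Alg.{u, v, w} L)} (hF : F.Finite)
    (hfin : ∀ A ∈ F, Finite A) (B : Alg.{u, v, w} L) :
    B ∈ quasivarietyGenerated F ↔ SeparatedBy F B := by
  constructor
  · rintro ⟨_, ⟨_, ⟨I, M, hM, rfl⟩, S, hS, rfl⟩, ⟨e⟩⟩
    refine SeparatedBy.of_hom (B := Alg.pi M) (fun x y hxy => ?_)
      ((Alg.subtype _ S hS).comp e.symm.toHom)
      ((Alg.subtype_injective _ S hS).comp e.symm.injective)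
    obtain ⟨i, hi⟩ := Function.ne_iff.1 hxy
    obtain ⟨J, U, N, hN, hMi⟩ := hM i
    have hs : SeparatedBy F (M i) := hMi ▸ separatedBy_ultraproduct hF hfin U N hN
    obtain ⟨P, hP, φ, hφ⟩ := hs _ _ hi
    exact ⟨P, hP, φ.comp (Alg.evalHom M i), hφ⟩
  · intro h
    have h' : ∀ p : {p : B × B // p.1 ≠ p.2}, ∃ N ∈ ClassPu F, ∃ φ : B →[L] N,
        φ p.1.1 ≠ φ p.1.2 := by
      rintro ⟨⟨x, y⟩, hxy⟩
      obtain ⟨M, hM, φ, hφ⟩ := h x y hxy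
      obtain ⟨N, hN, f, hf⟩ := exists_mem_classPu_equiv hM
      exact ⟨N, hN, f.comp φ, hf.ne hφ⟩
    choose N hN φ hφ using h'
    let f := Alg.piHom N φ
    have hf : Function.Injective f := by
      intro x y hxy
      by_contra hne
      exact hφ ⟨(x, y), hne⟩ (congrFun (β := fun i => N i) hxy _)
    have hne : Nonempty f.range := ⟨⟨f B.nonempty'.some, f.mem_range_self _⟩⟩
    let f' : B →[L] (Alg.pi N).sub f.range hne := f.codRestrict f.range f.mem_range_self
    have hf' : Function.Bijective f' :=
      ⟨fun x y hxy => hf (congrArg Subtype.val hxy),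
        fun ⟨_, x, hx⟩ => ⟨x, Subtype.ext hx⟩⟩
    let e : B ≃[L] (Alg.pi N).sub f.range hne :=
      { Equiv.ofBijective f' hf' with
        map_fun' := f'.map_fun'
        map_rel' := fun r => isEmptyElim r }
    exact ⟨_, ⟨_, ⟨_, N, hN, rfl⟩, f.range, hne, rfl⟩, ⟨e.symm⟩⟩

end Generation

end UniversalAlgebra

/-! ### Relatively subdirectly irreducible algebras -/

namespace UniversalAlgebra

open Filter

variable {L : FirstOrder.Language.{u, v}} [L.IsAlgebraic]

/-- The intersection of a set of congruences. -/
def Congruence.inter {A : Alg.{u, v, w} L} (T : Set (Congruence A)) : Congruence A where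
  r x y := ∀ θ ∈ T, θ.toSetoid x y
  iseqv := ⟨fun _ θ _ => θ.refl _, fun h θ hθ => θ.symm (h θ hθ),
    fun h h' θ hθ => θ.trans (h θ hθ) (h' θ hθ)⟩
  map_rel f x y h θ hθ := θ.map_rel f x y fun i => h i θ hθ

/-- If `Q` consists of the algebras separated by homomorphisms into `F`, then every intersection of
`Q`-congruences is a `Q`-congruence. -/
theorem separatedBy_quotient_inter {F : Set (Alg.{u, v, w} L)} {A : Alg.{u, v, w} L}
    {T : Set (Congruence A)} (hT : ∀ θ ∈ T, SeparatedBy F (A.quotient θ)) :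
    SeparatedBy F (A.quotient (Congruence.inter T)) := by
  intro x y hxy
  obtain ⟨x, rfl⟩ := A.quotientMk_surjective _ x
  obtain ⟨y, rfl⟩ := A.quotientMk_surjective _ y
  rw [Ne, Alg.quotientMk_eq_iff] at hxy
  have : ∃ θ ∈ T, ¬ θ.toSetoid x y := by
    by_contra! h
    exact hxy h
  obtain ⟨θ, hθ, hne⟩ := this
  rw [← Alg.quotientMk_eq_iff] at hne
  obtain ⟨M, hM, φ, hφ⟩ := hT θ hθ _ _ hne
  obtain ⟨g, hg⟩ := exists_comp_eq_of_surjective (A.quotientMk (Congruence.inter T))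
    (A.quotientMk_surjective _) (φ.comp (A.quotientMk θ)) (fun a b hab => by
      rw [Alg.quotientMk_eq_iff] at hab
      exact congrArg φ ((Alg.quotientMk_eq_iff _ _ _ _).2 (hab θ hθ)))
  exact ⟨M, hM, g, by rw [hg, hg]; exact hφ⟩

/-- An algebra of `Q` with two distinct points identified by every `Q`-congruence other than the
diagonal is relatively subdirectly irreducible. -/
theorem mem_classRSI_of_forall {F Q : Set (Alg.{u, v, w} L)}
    (hQ : ∀ B, B ∈ Q ↔ SeparatedBy F B) {A : Alg.{u, v, w} L} (hA : A ∈ Q) {a b : A}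
    (hab : a ≠ b) (h : ∀ θ : Congruence A, A.quotient θ ∈ Q → ¬ θ.toSetoid a b →
      θ ≤ Congruence.diagonal A) : A ∈ ClassRSI Q := by
  have hd : A.quotient (Congruence.diagonal A) ∈ Q := by
    obtain ⟨g, hg⟩ := exists_comp_eq_of_surjective (A.quotientMk (Congruence.diagonal A))
      (A.quotientMk_surjective _) (Hom.id L A) (fun x y hxy =>
        (Alg.quotientMk_eq_iff _ _ _ _).1 hxy)
    refine (hQ _).2 (((hQ A).1 hA).of_hom g fun x y hxy => ?_)
    obtain ⟨x, rfl⟩ := A.quotientMk_surjective _ x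
    obtain ⟨y, rfl⟩ := A.quotientMk_surjective _ y
    rw [hg, hg] at hxy
    exact congrArg (A.quotientMk _) hxy
  refine ⟨hA, hd, fun T hT => ?_⟩
  by_contra hnT
  have hmem : ∀ θ ∈ T, θ.1.toSetoid a b := by
    intro θ hθ
    by_contra hne
    have hle : θ.1 ≤ Congruence.diagonal A := h θ.1 θ.2 hne
    have : θ = ⟨Congruence.diagonal A, hd⟩ := le_antisymm hle (hT.1 hθ)
    exact hnT (this ▸ hθ)
  -- The intersection of `T` is a `Q`-congruence below every member of `T`, hence below their meet,
  -- the diagonal; yet it contains the pair `(a, b)`.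
  have hi : A.quotient (Congruence.inter (Subtype.val '' T)) ∈ Q := by
    refine (hQ _).2 (separatedBy_quotient_inter ?_)
    rintro _ ⟨θ, _, rfl⟩
    exact (hQ _).1 θ.2
  have hle : (⟨_, hi⟩ : RelCongruence Q A) ≤ ⟨Congruence.diagonal A, hd⟩ :=
    hT.2 fun θ hθ x y hxy => hxy θ.1 ⟨θ, hθ, rfl⟩
  refine hab (hle (x := a) (y := b) ?_)
  rintro _ ⟨θ, hθ, rfl⟩
  exact hmem θ hθ

/-- In a finitely generated quasivariety, the points of an algebra are separated by homomorphisms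
onto relatively subdirectly irreducible subalgebras of the generating algebras. -/
theorem exists_hom_separating_mem_classRSI {F Q : Set (Alg.{u, v, w} L)}
    (hfin : ∀ A ∈ F, Finite A) (hQ : ∀ B, B ∈ Q ↔ SeparatedBy F B) {B : Alg.{u, v, w} L}
    (hB : B ∈ Q) {x y : B} (hxy : x ≠ y) :
    ∃ M ∈ F, ∃ (S : L.Substructure M) (hS : Nonempty S), M.sub S hS ∈ ClassRSI Q ∧
      ∃ φ : B →[L] M.sub S hS, φ x ≠ φ y := by
  classical
  -- Choose a separating homomorphism whose image is smallest among all targets in `F`.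
  have hex : ∃ n : ℕ, ∃ M ∈ F, ∃ φ : B →[L] M, φ x ≠ φ y ∧ (Set.range φ).ncard = n := by
    obtain ⟨M, hM, φ, hφ⟩ := (hQ B).1 hB x y hxy
    exact ⟨_, M, hM, φ, hφ, rfl⟩
  obtain ⟨M, hM, φ, hφ, hn⟩ := Nat.find_spec hex
  have hmin : ∀ N ∈ F, ∀ χ : B →[L] N, χ x ≠ χ y →
      (Set.range φ).ncard ≤ (Set.range χ).ncard := by
    intro N hN χ hχ
    rw [hn]
    exact Nat.find_min' hex ⟨N, hN, χ, hχ, rfl⟩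
  have := hfin M hM
  have hS : Nonempty φ.range := ⟨⟨φ x, φ.mem_range_self x⟩⟩
  let E := M.sub φ.range hS
  let φ' : B →[L] E := φ.codRestrict φ.range φ.mem_range_self
  have hφ' : Function.Surjective φ' := fun ⟨_, b, hb⟩ => ⟨b, Subtype.ext hb⟩
  have hφxy : φ' x ≠ φ' y := fun h => hφ (congrArg Subtype.val h)
  have hE : E ∈ Q := (hQ E).2 fun a b hab =>
    ⟨M, hM, M.subtype φ.range hS, (M.subtype_injective φ.range hS).ne hab⟩
  refine ⟨M, hM, φ.range, hS, mem_classRSI_of_forall hQ hE hφxy fun θ hθ hne => ?_, φ', hφxy⟩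
  rw [← Alg.quotientMk_eq_iff] at hne
  obtain ⟨N, hN, ψ, hψ⟩ := (hQ _).1 hθ _ _ hne
  have := hfin N hN
  have : Finite E := Subtype.finite
  -- `χ` still separates the images of `x` and `y`, so by minimality its range is no smaller than
  -- `E`. It is therefore injective, and `θ` is the diagonal.
  let χ : E →[L] N := ψ.comp (E.quotientMk θ)
  have hle := hmin N hN (χ.comp φ') hψ
  have hr : Set.range (χ.comp φ') = Set.range χ := hφ'.range_comp χ
  rw [hr] at hle
  have hcard : (Set.range φ).ncard = Nat.card E := rfl
  have hinj : Function.Injective χ := by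
    rw [hcard, ← Set.image_univ, ← Set.ncard_univ] at hle
    exact Set.injOn_univ.1 (Set.injOn_of_ncard_image_eq
      (le_antisymm (Set.ncard_image_le Set.finite_univ) hle) Set.finite_univ)
  intro a b hab
  exact hinj (congrArg ψ ((Alg.quotientMk_eq_iff _ _ _ _).2 hab))

/-- The points of the members of a finitely generated quasivariety are separated by homomorphisms
into finitely many finite relatively subdirectly irreducible algebras. -/
theorem exists_finite_classRSI_separating {Q : Set (Alg.{u, v, w} L)} {F : Set (Alg.{u, v, w} L)}
    (hF : F.Finite) (hfin : ∀ A ∈ F, Finite A) (hQ : ∀ B, B ∈ Q ↔ SeparatedBy F B) :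
    ∃ R : Set (Alg.{u, v, w} L), R.Finite ∧ (∀ A ∈ R, Finite A) ∧ R ⊆ ClassRSI Q ∧
      ∀ B ∈ Q, SeparatedBy R B := by
  have := hF.to_subtype
  have : ∀ M : F, Finite M.1 := fun M => hfin M.1 M.2
  have : ∀ M : F, Finite (L.Substructure M.1) := fun M => Finite.of_injective
    (fun S => (S : Set M.1)) SetLike.coe_injective
  let f : (Σ M : F, {S : L.Substructure M.1 // Nonempty S}) → Alg.{u, v, w} L :=
    fun p => p.1.1.sub p.2.1 p.2.2
  refine ⟨Set.range f ∩ ClassRSI Q, (Set.finite_range f).inter_of_left _, ?_,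
    Set.inter_subset_right, ?_⟩
  · rintro _ ⟨⟨⟨M, S, hS⟩, rfl⟩, _⟩
    exact Subtype.finite (p := fun x => x ∈ S)
  · intro B hB x y hxy
    obtain ⟨M, hM, S, hS, hR, φ, hφ⟩ := exists_hom_separating_mem_classRSI hfin hQ hB hxy
    exact ⟨_, ⟨⟨⟨⟨M, hM⟩, S, hS⟩, rfl⟩, hR⟩, φ, hφ⟩

end UniversalAlgebra

/-! ### The Baker–Pixley argument and transfer of epimorphisms -/

namespace UniversalAlgebra

open Filter
open FirstOrder.Language.Substructure (subset_closure)

variable {L : FirstOrder.Language.{u, v}}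

/-- A step of the Baker–Pixley theorem: if an element `b` agrees with elements of a subuniverse `A`
on every pair of homomorphisms of a family into algebras with a majority term, then it does so on
every finite set of them. -/
theorem exists_mem_forall_eq_of_majority {P : Type*} [L.Structure P] (A : L.Substructure P) (b : P)
    {K : Set (Alg.{u, v, w} L)} {t : L.Term (Fin 3)} (ht : IsMajorityTerm K t) {ι : Type*}
    (C : ι → Alg.{u, v, w} L) (hC : ∀ i, C i ∈ K) (f : ∀ i, P →[L] C i)
    (h : ∀ i j, ∃ a ∈ A, f i a = f i b ∧ f j a = f j b) (J : Finset ι) (i j : ι) :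
    ∃ a ∈ A, (∀ k ∈ J, f k a = f k b) ∧ f i a = f i b ∧ f j a = f j b := by
  classical
  induction J using Finset.induction_on generalizing i j with
  | empty =>
    obtain ⟨a, ha, h1, h2⟩ := h i j
    exact ⟨a, ha, by simp, h1, h2⟩
  | insert k J _ ih =>
    -- Each of `i`, `j`, `k` is matched by two of the three elements and each index in `J` by all
    -- three, so the majority term matches `b` everywhere.
    obtain ⟨a₁, ha₁, hJ₁, hi₁, hj₁⟩ := ih i j
    obtain ⟨a₂, ha₂, hJ₂, hk₂, hi₂⟩ := ih k i
    obtain ⟨a₃, ha₃, hJ₃, hk₃, hj₃⟩ := ih k j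
    have key : ∀ l, f l (t.realize ![a₁, a₂, a₃]) = t.realize ![f l a₁, f l a₂, f l a₃] := by
      intro l
      rw [← HomClass.realize_term (f l)]
      congr 1
      ext m
      fin_cases m <;> rfl
    have h12 : ∀ l, f l a₁ = f l b → f l a₂ = f l b →
        f l (t.realize ![a₁, a₂, a₃]) = f l b := by
      intro l h1 h2
      rw [key, h1, h2]
      exact (ht _ (hC l) _ _).1
    have h13 : ∀ l, f l a₁ = f l b → f l a₃ = f l b →
        f l (t.realize ![a₁, a₂, a₃]) = f l b := by
      intro l h1 h2
      rw [key, h1, h2]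
      exact (ht _ (hC l) _ _).2.1
    have h23 : ∀ l, f l a₂ = f l b → f l a₃ = f l b →
        f l (t.realize ![a₁, a₂, a₃]) = f l b := by
      intro l h1 h2
      rw [key, h1, h2]
      exact (ht _ (hC l) _ _).2.2
    refine ⟨t.realize ![a₁, a₂, a₃], t.realize_mem _ ?_, ?_, h12 _ hi₁ hi₂, h13 _ hj₁ hj₃⟩
    · intro m
      fin_cases m
      exacts [ha₁, ha₂, ha₃]
    · intro l hl
      rcases Finset.mem_insert.1 hl with rfl | hl
      · exact h23 _ hk₂ hk₃
      · exact h12 _ (hJ₁ l hl) (hJ₂ l hl)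

/-- There are finitely many homomorphisms from a finitely generated algebra to a finite one. -/
theorem finite_hom_closure {B N : Type*} [L.Structure B] [L.Structure N] [Finite N] {X : Set B}
    (hX : X.Finite) : Finite (Substructure.closure L X →[L] N) := by
  have := hX.to_subtype
  refine Finite.of_injective
    (fun (f : Substructure.closure L X →[L] N) (x : X) => f ⟨x, subset_closure x.2⟩)
    fun f g hfg => ?_
  -- The equalizer lives inside the closure; its image in `B` is a subuniverse containing `X`.
  have hle : Substructure.closure L X ≤
      (f.eqLocus g).map (Substructure.closure L X).subtype.toHom :=
    Substructure.closure_le.2 fun x hx =>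
      ⟨⟨x, subset_closure hx⟩, congrFun hfg ⟨x, hx⟩, rfl⟩
  ext ⟨x, hx⟩
  obtain ⟨y, hy, rfl⟩ := hle hx
  exact hy

/-- If the points of the members of `Q` are separated by homomorphisms into `R`, whose members embed
in members of `K`, then `K`-epimorphisms are `Q`-epimorphisms. -/
theorem IsEpimorphismIn.of_separatedBy {K Q R : Set (Alg.{u, v, w} L)}
    (hsep : ∀ C ∈ Q, SeparatedBy R C)
    (hRK : ∀ M ∈ R, ∃ N ∈ K, ∃ f : M →[L] N, Function.Injective f) {A B : Alg.{u, v, w} L}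
    {h : A →[L] B} (hh : IsEpimorphismIn K h) : IsEpimorphismIn Q h := by
  intro C hC g g' hg
  by_contra hne
  have : ∃ x, g x ≠ g' x := by
    by_contra! hx
    exact hne (Hom.ext hx)
  obtain ⟨x, hx⟩ := this
  obtain ⟨M, hM, φ, hφ⟩ := hsep C hC _ _ hx
  obtain ⟨N, hN, f, hf⟩ := hRK M hM
  have heq := hh N hN ((f.comp φ).comp g) ((f.comp φ).comp g') (by
    rw [Hom.comp_assoc, hg, ← Hom.comp_assoc])
  exact hφ (hf (DFunLike.congr_fun heq x))

/-- If a subclass `K` of `Q` has surjective epimorphisms and contains all subalgebras of `P`, then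
the image of a `Q`-epimorphism is sent by every homomorphism to `P` onto its whole image. -/
theorem exists_range_eq_of_hasSurjectiveEpimorphisms {K Q : Set (Alg.{u, v, w} L)} (hKQ : K ⊆ Q)
    {A B P : Alg.{u, v, w} L} {h : A →[L] B} (hh : IsEpimorphismIn Q h) (p : B →[L] P)
    (hP : ∀ (S : L.Substructure P) (hS : Nonempty S), P.sub S hS ∈ K)
    (hK : HasSurjectiveEpimorphisms K) (b : B) : ∃ a, p (h a) = p b := by
  have hD : Nonempty (p.comp h).range := ⟨⟨_, (p.comp h).mem_range_self A.nonempty'.some⟩⟩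
  have hE : Nonempty p.range := ⟨⟨_, p.mem_range_self b⟩⟩
  have hle : (p.comp h).range ≤ p.range := Hom.range_comp_le_range h p
  let ι : P.sub _ hD →[L] P.sub _ hE := (Substructure.inclusion hle).toHom
  let p' : B →[L] P.sub _ hE := p.codRestrict p.range p.mem_range_self
  have hp' : Function.Surjective p' := fun ⟨_, x, hx⟩ => ⟨x, Subtype.ext hx⟩
  -- Two maps that agree on `p (h A)` agree after composing with `p' ∘ h`; cancel `h` as a
  -- `Q`-epimorphism, then the surjection `p'`.
  have hι : IsEpimorphismIn K ι := by
    intro C hC g g' hg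
    have : g.comp p' = g'.comp p' := hh C (hKQ hC) _ _ (Hom.ext fun a =>
      DFunLike.congr_fun hg (⟨_, (p.comp h).mem_range_self a⟩ : (p.comp h).range))
    ext e
    obtain ⟨x, rfl⟩ := hp' e
    exact DFunLike.congr_fun this x
  obtain ⟨⟨_, a, rfl⟩, ha⟩ := hK _ (hP _ hD) _ (hP _ hE) ι hι (p' b)
  exact ⟨a, congrArg Subtype.val ha⟩

/-! ### Separating a point from a subuniverse by two homomorphisms -/

section Separation

variable {R : Set (Alg.{u, v, w} L)} {t : L.Term (Fin 3)} {B : Alg.{u, v, w} L}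
  (A : L.Substructure B) {b : B}

/-- On a finitely generated subalgebra, a point outside a subuniverse is separated from it by a
pair of homomorphisms into a finite set of finite algebras with a majority term. -/
theorem exists_pair_separating_closure (hR : R.Finite) (hfin : ∀ M ∈ R, Finite M)
    (ht : IsMajorityTerm R t) (hb : b ∉ A) {a₀ : B} (ha₀ : a₀ ∈ A) {X : Set B} (hX : X.Finite)
    (hbX : b ∈ X) (haX : a₀ ∈ X)
    (hsep : ∀ S : L.Substructure B, ∀ hS : Nonempty S, SeparatedBy R (B.sub S hS)) :
    ∃ M ∈ R, ∃ N ∈ R, ∃ (f : Substructure.closure L X →[L] M)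
      (g : Substructure.closure L X →[L] N),
      ∀ x (hx : x ∈ Substructure.closure L X), x ∈ A →
        ¬ (f ⟨x, hx⟩ = f ⟨b, subset_closure hbX⟩ ∧
          g ⟨x, hx⟩ = g ⟨b, subset_closure hbX⟩) := by
  classical
  by_contra! hcon
  have := hR.to_subtype
  have : ∀ M : R, Finite M.1 := fun M => hfin M.1 M.2
  have : ∀ M : R, Finite (Substructure.closure L X →[L] M.1) := fun M => finite_hom_closure hX
  let ι := Σ M : R, Substructure.closure L X →[L] M.1
  have := Fintype.ofFinite ι
  let b' : Substructure.closure L X := ⟨b, subset_closure hbX⟩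
  let a' : Substructure.closure L X := ⟨a₀, subset_closure haX⟩
  have hsepX := hsep (Substructure.closure L X) ⟨b'⟩
  -- The majority lemma needs some index to start from. Separating `a₀` from `b` supplies one; this
  -- is where nonemptiness of `A` enters.
  obtain ⟨M₀, hM₀, φ₀, -⟩ := hsepX a' b' fun h => hb (by
    have hab : a₀ = b := congrArg Subtype.val h
    exact hab ▸ ha₀)
  let i₀ : ι := ⟨⟨M₀, hM₀⟩, φ₀⟩
  obtain ⟨a, ha, hab, -⟩ := exists_mem_forall_eq_of_majority
    (A.comap (Substructure.closure L X).subtype.toHom) b' ht (ι := ι)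
    (fun i => i.1.1) (fun i => i.1.2)
    (fun i => i.2) (fun i j => by
      obtain ⟨x, hx, hxA, h1, h2⟩ := hcon i.1.1 i.1.2 j.1.1 j.1.2 i.2 j.2
      exact ⟨⟨x, hx⟩, hxA, h1, h2⟩) Finset.univ i₀ i₀
  have hne : a ≠ b' := by
    rintro rfl
    -- An element of `A` matching `b` under every homomorphism into `R` would equal `b`, by
    -- separation.
    exact hb ha
  obtain ⟨M, hM, φ, hφ⟩ := hsepX a b' hne
  exact hφ (hab ⟨⟨M, hM⟩, φ⟩ (Finset.mem_univ _))

/-- A point outside a nonempty subuniverse is separated from it by a pair of homomorphisms into a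
finite set of finite algebras with a majority term that separates the points of subalgebras. -/
theorem exists_pair_separating [L.IsAlgebraic] (hR : R.Finite) (hfin : ∀ M ∈ R, Finite M)
    (ht : IsMajorityTerm R t) (hb : b ∉ A) {a₀ : B} (ha₀ : a₀ ∈ A)
    (hsep : ∀ S : L.Substructure B, ∀ hS : Nonempty S, SeparatedBy R (B.sub S hS)) :
    ∃ M ∈ R, ∃ N ∈ R, ∃ (f : B →[L] M) (g : B →[L] N),
      ∀ a ∈ A, ¬ (f a = f b ∧ g a = g b) := by
  classical
  have := hR.to_subtype
  -- Local solutions: maps on all of `B` that respect operations applied to elements of `X` and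
  -- separate `b` from `A` within `X`.
  have hloc : ∀ X : Finset B, ∃ p : R × R, ∃ (f : B → p.1.1) (g : B → p.2.1),
      (∀ {n : ℕ} (F : L.Functions n) (x : Fin n → B), (∀ i, x i ∈ X) →
        f (Structure.funMap F x) = Structure.funMap F (f ∘ x) ∧
        g (Structure.funMap F x) = Structure.funMap F (g ∘ x)) ∧
      ∀ a ∈ X, a ∈ A → ¬ (f a = f b ∧ g a = g b) := by
    intro X
    let Y : Set B := insert b (insert a₀ X)
    have hY : Y.Finite := (X.finite_toSet.insert _).insert _
    obtain ⟨M, hM, N, hN, f, g, h⟩ := exists_pair_separating_closure A hR hfin ht hb ha₀ hY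
      (Set.mem_insert _ _) (Set.mem_insert_of_mem _ (Set.mem_insert _ _)) hsep
    let r : B → Substructure.closure L Y := fun x =>
      if hx : x ∈ Substructure.closure L Y then ⟨x, hx⟩ else
        ⟨b, subset_closure (Set.mem_insert _ _)⟩
    have hr : ∀ x (hx : x ∈ Substructure.closure L Y), r x = ⟨x, hx⟩ := fun x hx => dif_pos hx
    have hXY : ∀ x ∈ X, x ∈ Substructure.closure L Y := fun x hx =>
      subset_closure (Set.mem_insert_of_mem _ (Set.mem_insert_of_mem _ hx))
    have hrF : ∀ {n : ℕ} (F : L.Functions n) (x : Fin n → B), (∀ i, x i ∈ X) →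
        r (Structure.funMap F x) = Structure.funMap F (r ∘ x) := by
      intro n F x hx
      rw [hr _ ((Substructure.closure L Y).fun_mem F x fun i => hXY _ (hx i))]
      apply Subtype.ext
      change Structure.funMap F x = Structure.funMap F (fun i => (r (x i) : B))
      congr 1
      funext i
      rw [hr _ (hXY _ (hx i))]
    refine ⟨⟨⟨M, hM⟩, ⟨N, hN⟩⟩, f ∘ r, g ∘ r, fun F x hx => ?_, fun a ha haA => ?_⟩
    · simp only [Function.comp_apply, hrF F x hx, Hom.map_fun]
      exact ⟨rfl, rfl⟩
    · simp only [Function.comp_apply, hr a (hXY a ha), hr b (subset_closure (Set.mem_insert _ _))]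
      exact h a _ haA
  choose p hp using hloc
  -- Along an ultrafilter finer than `atTop`, each element of `B` is eventually in `X`, so local
  -- conditions become global in the limit.
  let U : Ultrafilter (Finset B) := Ultrafilter.of atTop
  have hU : ∀ x, ∀ᶠ X : Finset B in (U : Filter (Finset B)), x ∈ X := fun x =>
    Ultrafilter.of_le _ ((eventually_ge_atTop {x}).mono fun X hX =>
      hX (Finset.mem_singleton_self x))
  obtain ⟨q, hq⟩ := exists_eventually_eq U p
  -- Since `R` is finite, the target pair is eventually a fixed `q`; the local maps are retyped to
  -- that target, with constants where `p X ≠ q`.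
  have hq' : ∀ X, ∃ (f : B → q.1.1) (g : B → q.2.1), p X = q →
      (∀ {n : ℕ} (F : L.Functions n) (x : Fin n → B), (∀ i, x i ∈ X) →
        f (Structure.funMap F x) = Structure.funMap F (f ∘ x) ∧
        g (Structure.funMap F x) = Structure.funMap F (g ∘ x)) ∧
      ∀ a ∈ X, a ∈ A → ¬ (f a = f b ∧ g a = g b) := by
    intro X
    by_cases h : p X = q
    · obtain ⟨f, g, hfg⟩ := h ▸ hp X
      exact ⟨f, g, fun _ => hfg⟩
    · exact ⟨fun _ => q.1.1.nonempty'.some, fun _ => q.2.1.nonempty'.some, fun h' => absurd h' h⟩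
  choose f g hfg using hq'
  have := hfin _ q.1.2
  have := hfin _ q.2.2
  have hF : ∀ {n : ℕ} (F : L.Functions n) (x : Fin n → B), ∀ᶠ X in (U : Filter (Finset B)),
      f X (Structure.funMap F x) = Structure.funMap F (f X ∘ x) ∧
      g X (Structure.funMap F x) = Structure.funMap F (g X ∘ x) := by
    intro n F x
    filter_upwards [hq, eventually_all.2 fun i => hU (x i)] with X h1 h2
    exact (hfg X h1).1 F x h2
  obtain ⟨f', hf'⟩ := exists_hom_eventually_eq U f fun F x => (hF F x).mono fun _ h => h.1
  obtain ⟨g', hg'⟩ := exists_hom_eventually_eq U g fun F x => (hF F x).mono fun _ h => h.2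
  refine ⟨q.1.1, q.1.2, q.2.1, q.2.2, f', g', fun a ha => ?_⟩
  obtain ⟨X, h1, h2, h3, h4, h5, h6⟩ := ((hf' a).and ((hf' b).and ((hg' a).and
    ((hg' b).and (hq.and (hU a)))))).exists
  rw [← h1, ← h2, ← h3, ← h4]
  exact (hfg X h5).2 a h6 ha

end Separation

/-! ### Subalgebras of binary products -/

variable [L.IsAlgebraic]

/-- Every algebra of `K` embeds in a subalgebra of its square. -/
theorem exists_mem_classS_classSquare {K : Set (Alg.{u, v, w} L)} {M : Alg.{u, v, w} L}
    (hM : M ∈ K) :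
    ∃ N ∈ ClassS (ClassSquare K), ∃ f : M →[L] N, Function.Injective f := by
  let δ : M →[L] M.prod M := Alg.pair (Hom.id L M) (Hom.id L M)
  have hne : Nonempty δ.range := ⟨⟨δ M.nonempty'.some, δ.mem_range_self _⟩⟩
  refine ⟨(M.prod M).sub δ.range hne, ⟨_, ⟨M, hM, M, hM, rfl⟩, _, hne, rfl⟩,
    δ.codRestrict δ.range δ.mem_range_self, fun x y hxy => ?_⟩
  exact ((Alg.pair_eq_iff _ _ _ _).1 (congrArg Subtype.val hxy)).1

theorem classS_classSquare_subset {F Q : Set (Alg.{u, v, w} L)}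
    (hQ : ∀ B, B ∈ Q ↔ SeparatedBy F B) {K : Set (Alg.{u, v, w} L)} (hK : K ⊆ Q) :
    ClassS (ClassSquare K) ⊆ Q := by
  rintro _ ⟨_, ⟨A, hA, B, hB, rfl⟩, S, hS, rfl⟩
  refine (hQ _).2 (SeparatedBy.of_hom (fun x y hxy => ?_) _ (Alg.subtype_injective _ S hS))
  by_cases h : A.fst B x = A.fst B y
  · have h' : A.snd B x ≠ A.snd B y := fun h' => hxy (Alg.prod_ext h h')
    obtain ⟨M, hM, φ, hφ⟩ := (hQ B).1 (hK hB) _ _ h'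
    exact ⟨M, hM, φ.comp (A.snd B), hφ⟩
  · obtain ⟨M, hM, φ, hφ⟩ := (hQ A).1 (hK hA) _ _ h
    exact ⟨M, hM, φ.comp (A.fst B), hφ⟩

end UniversalAlgebra

/-! ### The equivalence -/

open UniversalAlgebra in
theorem corollary4p3 {L : FirstOrder.Language.{u, v}} [L.IsAlgebraic]
    (Q : Set (UniversalAlgebra.Alg.{u, v, w} L))
    (hQ : UniversalAlgebra.IsFinitelyGeneratedQuasivariety Q)
    (hM : UniversalAlgebra.HasMajorityTerm Q) :
    UniversalAlgebra.HasSurjectiveEpimorphisms Q ↔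
      UniversalAlgebra.HasSurjectiveEpimorphisms
        (UniversalAlgebra.ClassS
          (UniversalAlgebra.ClassSquare (UniversalAlgebra.ClassRSI Q))) := by
  obtain ⟨F, hF, hfin, rfl⟩ := hQ
  obtain ⟨t, ht⟩ := hM
  have hQ := mem_quasivarietyGenerated_iff hF hfin
  obtain ⟨R, hR, hRfin, hRSI, hsep⟩ := exists_finite_classRSI_separating hF hfin hQ
  have hKQ := classS_classSquare_subset hQ
    (fun A (hA : A ∈ ClassRSI (quasivarietyGenerated F)) => hA.1)
  constructor
  · intro hS A hA B hB h hh
    exact hS A (hKQ hA) B (hKQ hB) h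
      (hh.of_separatedBy hsep fun M hM => exists_mem_classS_classSquare (hRSI hM))
  · intro hS A hA B hB h hh
    by_contra hns
    obtain ⟨b, hb⟩ := not_forall.1 hns
    obtain ⟨M, hM, N, hN, f, g, hfg⟩ := exists_pair_separating h.range hR hRfin
      (fun M hM => ht M (hRSI hM).1) hb (h.mem_range_self A.nonempty'.some)
      (fun S hS => hsep _ ((hQ _).2 (((hQ B).1 hB).of_hom _ (B.subtype_injective S hS))))
    -- All subalgebras of `M × N` lie in the second class, so some point of the range of `h` has the
    -- same image as `b`, against the choice of `f` and `g`.
    obtain ⟨a, ha⟩ := exists_range_eq_of_hasSurjectiveEpimorphisms hKQ hh (Alg.pair f g)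
      (fun S hS' => ⟨_, ⟨M, hRSI hM, N, hRSI hN, rfl⟩, S, hS', rfl⟩) hS b
    exact hfg _ (h.mem_range_self a) ((Alg.pair_eq_iff _ _ _ _).1 ha)
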